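/- Let $k$ be a field of characteristic different from $2$ and $3$, let $\hat k/k$ be a quadratic extension, and let $z\mapsto\bar z$ be the nontrivial element of $\mathrm{Gal}(\hat k/k)$, acting also on binary cubics over $\hat k$ through their coefficients and on $\hat k^*/\hat k^{*3}$. For a binary cubic $P=ax^3+3bx^2y+3cxy^2+dy^3$ put $$Q_n(P)=a^2d^2-3b^2c^2-6abcd+4b^3d+4ac^3,$$ and for a second cubic $P'$ with coefficients $a',b',c',d'$ put $\omega(P,P')=ad'-da'-3bc'+3cb'$. The group $\mathrm{Sl}(2,k)$ acts on binary cubics over $k$ by the substitution in which $\begin{pmatrix}\alpha&\beta\\\gamma&\delta\end{pmatrix}$ sends $x\mapsto\delta x-\beta y$, $y\mapsto-\gamma x+\alpha y$. Let $$\mathrm{Im}\,\hat k^*=\{q\in\hat k^*:\bar q=-q\},\qquad U(\hat k^*/\hat k^{*3})=\{s\in\hat k^*/\hat k^{*3}: s\bar s=1\},$$ let $\hat k^*\times_{Z_2}\hat k^*/\hat k^{*3}$ be the quotient of $\hat k^*\times\hat k^*/\hat k^{*3}$ by the involution $(q,s)\mapsto(-q,s^{-1})$, and let $\mathrm{Im}\,\hat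 k^*\times_{Z_2}U(\hat k^*/\hat k^{*3})$ be the image in it of the stable subset $\mathrm{Im}\,\hat k^*\times U(\hat k^*/\hat k^{*3})$. Let $$\mathcal O(\hat k)=\{P \text{ a binary cubic over } k:\ Q_n(P)=q^2\text{ for some } q\in\mathrm{Im}\,\hat k^*\}.$$ (0) $\mathcal O(\hat k)$ is the set of binary cubics $P$ over $k$ such that $\hat k$ is a splitting field of $X^2-Q_n(P)$ over $k$, and it is also the set of binary cubics $P$ over $k$ of the form $P=T+\bar T$, where $T$ is a nonzero multiple of the cube of a linear form over $\hat k$ and $T,\bar T$ are coprime. For $P\in\mathcal O(\hat k)$ and any expression $P=\lambda_1\phi_1^3+\lambda_2\phi_2^3$ with $\lambda_1,\lambda_2\in\hat k^*$, linear forms $\phi_1,\phi_2$ over $\hat k$ and coprime summands, the number $\omega(\lambda_1\phi_1^3,\lambda_2\phi_2^3)$ is nonzero and the class $$I(P)=[\,\omega(\lambda_1\phi_1^3,\lambda_2\phi_2^3),\,[\lambda_1][\lambda_2]^{-1}\,]\in\hat k^*\times_{Z_2}\hat k^*/\hat k^{*3}$$ does not depend on the expression. In particular $I(P)=[\,\omega(\lambda\alpha^3,\bar\lambda\bar\alpha^3),[\lambda\bar\lambda^{-1}]\,]$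 if $P=\lambda\alpha^3+\bar\lambda\bar\alpha^3$ with coprime summands. (i) For $P,P'\in\mathcal O(\hat k)$: $\mathrm{Sl}(2,k)\cdot P'=\mathrm{Sl}(2,k)\cdot P$ if and only if $I(P')=I(P)$. (ii) The map $I$ takes values in $\mathrm{Im}\,\hat k^*\times_{Z_2}U(\hat k^*/\hat k^{*3})$ and induces a bijection $$\mathcal O(\hat k)/\mathrm{Sl}(2,k)\longleftrightarrow\mathrm{Im}\,\hat k^*\times_{Z_2}U(\hat k^*/\hat k^{*3}).$$ (iii) The isotropy group in $\mathrm{Sl}(2,k)$ of any $P\in\mathcal O(\hat k)$ is isomorphic to $$\left\{\begin{pmatrix}\lambda&0\\0&\bar\lambda\end{pmatrix}\in\mathrm{Sl}(2,\hat k):\ \lambda^3=1,\ \lambda\bar\lambda=1\right\}.$$ -/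

import Mathlib

/-- The binary cubic `a x³ + 3 b x² y + 3 c x y² + d y³` over `K`. -/
@[ext]
structure BinaryCubic (K : Type*) where
  a : K
  b : K
  c : K
  d : K

namespace BinaryCubic

section Basic

variable {K L : Type*} [Field K] [Field L]

instance : Zero (BinaryCubic K) := ⟨⟨0, 0, 0, 0⟩⟩

instance : Add (BinaryCubic K) := ⟨fun P R => ⟨P.a + R.a, P.b + R.b, P.c + R.c, P.d + R.d⟩⟩

/-- Multiplication of a cubic by a scalar. -/
def scale (l : K) (P : BinaryCubic K) : BinaryCubic K := ⟨l * P.a, l * P.b, l * P.c, l * P.d⟩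

/-- The cubic as a polynomial in `x = X 0`, `y = X 1`. -/
noncomputable def toPoly (P : BinaryCubic K) : MvPolynomial (Fin 2) K :=
  MvPolynomial.C P.a * MvPolynomial.X 0 ^ 3
    + MvPolynomial.C (3 * P.b) * MvPolynomial.X 0 ^ 2 * MvPolynomial.X 1
    + MvPolynomial.C (3 * P.c) * MvPolynomial.X 0 * MvPolynomial.X 1 ^ 2
    + MvPolynomial.C P.d * MvPolynomial.X 1 ^ 3

/-- Two cubics are coprime: they have no common factor of positive degree in `K[x, y]`
(every common divisor is a unit). -/
def Coprime (P R : BinaryCubic K) : Prop := IsRelPrime P.toPoly R.toPoly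

/-- The cube of the linear form `φ 0 x + φ 1 y`. -/
def cube (φ : Fin 2 → K) : BinaryCubic K :=
  ⟨φ 0 ^ 3, φ 0 ^ 2 * φ 1, φ 0 * φ 1 ^ 2, φ 1 ^ 3⟩

theorem toPoly_scale_cube (l : K) (φ : Fin 2 → K) :
    (scale l (cube φ)).toPoly =
      MvPolynomial.C l * (MvPolynomial.C (φ 0) * MvPolynomial.X 0
        + MvPolynomial.C (φ 1) * MvPolynomial.X 1) ^ 3 := by
  simp only [toPoly, scale, cube, map_mul, map_pow, map_ofNat]
  ring

/-- The symplectic form on binary cubics. -/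
def omega (P R : BinaryCubic K) : K := P.a * R.d - P.d * R.a - 3 * P.b * R.c + 3 * P.c * R.b

/-- The moment map. -/
def moment (P : BinaryCubic K) : Matrix (Fin 2) (Fin 2) K :=
  !![P.a * P.d - P.b * P.c, 2 * (P.b * P.d - P.c ^ 2);
     2 * (P.b ^ 2 - P.a * P.c), -(P.a * P.d - P.b * P.c)]

/-- The normalised quartic invariant. -/
def Qn (P : BinaryCubic K) : K := -P.moment.det

theorem Qn_eq (P : BinaryCubic K) :
    P.Qn = P.a ^ 2 * P.d ^ 2 - 3 * P.b ^ 2 * P.c ^ 2 - 6 * P.a * P.b * P.c * P.d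
      + 4 * P.b ^ 3 * P.d + 4 * P.a * P.c ^ 3 := by
  simp only [Qn, moment, Matrix.det_fin_two_of]
  ring

/-- Base change along a ring homomorphism (applied to the coefficients). -/
def map (f : K →+* L) (P : BinaryCubic K) : BinaryCubic L := ⟨f P.a, f P.b, f P.c, f P.d⟩

/-- The nonzero cubics with a triple root, i.e. nonzero multiples of cubes of linear forms. -/
def tripleRoot (K : Type*) [Field K] : Set (BinaryCubic K) :=
  {T | T ≠ 0 ∧ ∃ (l : K) (φ : Fin 2 → K), T = scale l (cube φ)}

/-- The action of `SL(2, K)` on cubics by substitution: `g = (α β; γ δ)` sends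
`x` to `δ x - β y` and `y` to `-γ x + α y`. See `toPoly_smul`. -/
instance : SMul (Matrix.SpecialLinearGroup (Fin 2) K) (BinaryCubic K) :=
  ⟨fun g P =>
    let α := g.1 0 0
    let β := g.1 0 1
    let γ := g.1 1 0
    let δ := g.1 1 1
    ⟨P.a * δ ^ 3 - 3 * P.b * δ ^ 2 * γ + 3 * P.c * δ * γ ^ 2 - P.d * γ ^ 3,
     -P.a * δ ^ 2 * β + P.b * (δ ^ 2 * α + 2 * δ * β * γ)
       - P.c * (2 * δ * γ * α + β * γ ^ 2) + P.d * γ ^ 2 * α,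
     P.a * δ * β ^ 2 - P.b * (2 * δ * β * α + β ^ 2 * γ)
       + P.c * (δ * α ^ 2 + 2 * α * β * γ) - P.d * γ * α ^ 2,
     -P.a * β ^ 3 + 3 * P.b * β ^ 2 * α - 3 * P.c * β * α ^ 2 + P.d * α ^ 3⟩⟩

theorem toPoly_smul (g : Matrix.SpecialLinearGroup (Fin 2) K) (P : BinaryCubic K) :
    (g • P).toPoly = MvPolynomial.aeval
      ![MvPolynomial.C (g.1 1 1) * MvPolynomial.X 0 - MvPolynomial.C (g.1 0 1) * MvPolynomial.X 1,
        -MvPolynomial.C (g.1 1 0) * MvPolynomial.X 0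
          + MvPolynomial.C (g.1 0 0) * (MvPolynomial.X 1 : MvPolynomial (Fin 2) K)] P.toPoly := by
  simp only [HSMul.hSMul, SMul.smul, toPoly, map_add, map_sub, map_mul, map_neg, map_pow, map_ofNat,
    MvPolynomial.aeval_X, MvPolynomial.aeval_C, MvPolynomial.algebraMap_eq,
    Matrix.cons_val_zero, Matrix.cons_val_one]
  ring

instance : MulAction (Matrix.SpecialLinearGroup (Fin 2) K) (BinaryCubic K) where
  one_smul P := by
    ext <;> simp [HSMul.hSMul, SMul.smul]
  mul_smul g h P := by
    ext <;>
    · simp only [HSMul.hSMul, SMul.smul, Matrix.SpecialLinearGroup.coe_mul, Matrix.mul_apply,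
        Fin.sum_univ_two]
      ring

theorem Qn_smul (g : Matrix.SpecialLinearGroup (Fin 2) K) (P : BinaryCubic K) :
    (g • P).Qn = P.Qn := by
  have hg : g.1 0 0 * g.1 1 1 - g.1 0 1 * g.1 1 0 = 1 := by
    rw [← Matrix.det_fin_two]; exact g.2
  have key : (g • P).Qn = (g.1 0 0 * g.1 1 1 - g.1 0 1 * g.1 1 0) ^ 6 * P.Qn := by
    simp only [Qn_eq, HSMul.hSMul, SMul.smul]
    ring
  rw [key, hg, one_pow, one_mul]

end Basic

section Parameters

variable (K : Type*) [Field K]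

/-- The subgroup `K*³` of `K*`. -/
def cubes : Subgroup Kˣ := (powMonoidHom 3 : Kˣ →* Kˣ).range

/-- The group `K*/K*³`. -/
def CubeClass : Type _ := Kˣ ⧸ cubes K

instance : CommGroup (CubeClass K) := QuotientGroup.Quotient.commGroup (cubes K)

/-- The class map `K* → K*/K*³`. -/
def CubeClass.mk {K : Type*} [Field K] : Kˣ →* CubeClass K := QuotientGroup.mk' (cubes K)

/-- The relation on `K* × K*/K*³` whose classes are the orbits of the action
`-1 · (q, s) = (-q, s⁻¹)` of `Z₂`. -/
def paramSetoid : Setoid (Kˣ × CubeClass K) where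
  r p p' := p' = p ∨ p' = (-p.1, p.2⁻¹)
  iseqv :=
    { refl := fun _ => Or.inl rfl
      symm := by
        rintro p p' (rfl | rfl)
        · exact Or.inl rfl
        · right; simp
      trans := by
        rintro p p' p'' (rfl | rfl) (rfl | rfl)
        · exact Or.inl rfl
        · exact Or.inr rfl
        · exact Or.inr rfl
        · left; simp }

/-- The space `K* ×_{Z₂} K*/K*³`. -/
def OrbitParam : Type _ := Quotient (paramSetoid K)

variable {K}

/-- The class `[q, s]` in `K* ×_{Z₂} K*/K*³`. -/
def OrbitParam.mk (q : Kˣ) (s : CubeClass K) : OrbitParam K := Quotient.mk (paramSetoid K) (q, s)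

instance : Nonempty (OrbitParam K) := ⟨OrbitParam.mk 1 1⟩

/-- `P = l₁ φ₁³ + l₂ φ₂³` with coprime summands. -/
def IsCubeSum (P : BinaryCubic K) (l₁ l₂ : Kˣ) (φ₁ φ₂ : Fin 2 → K) : Prop :=
  P = scale (l₁ : K) (cube φ₁) + scale (l₂ : K) (cube φ₂) ∧
    Coprime (scale (l₁ : K) (cube φ₁)) (scale (l₂ : K) (cube φ₂))

/-- `x = [ω(T₁, T₂), [l₁][l₂]⁻¹]` for some way of writing `P` as a sum of coprime
`T₁ = l₁ φ₁³` and `T₂ = l₂ φ₂³`. -/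
def IsInvariantValue (P : BinaryCubic K) (x : OrbitParam K) : Prop :=
  ∃ (l₁ l₂ : Kˣ) (φ₁ φ₂ : Fin 2 → K) (q : Kˣ), IsCubeSum P l₁ l₂ φ₁ φ₂ ∧
    (q : K) = omega (scale (l₁ : K) (cube φ₁)) (scale (l₂ : K) (cube φ₂)) ∧
    x = OrbitParam.mk q (CubeClass.mk l₁ * (CubeClass.mk l₂)⁻¹)

/-- The invariant `I(P) = [ω(T₁, T₂), [l₁][l₂]⁻¹]` of a sum `P` of coprime cubes
`T₁ = l₁ φ₁³`, `T₂ = l₂ φ₂³` (an arbitrary value if `P` is no such sum). -/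
noncomputable def orbitInvariant (P : BinaryCubic K) : OrbitParam K :=
  Classical.epsilon (IsInvariantValue P)

end Parameters

section Quadratic

variable {k K : Type*} [Field k] [Field K] [Algebra k K]

/-- The cubics over `k` with `Q_n(P) = q²` for some nonzero `q ∈ K` with `q̄ = -q`,
with the action of `SL(2, k)`. -/
def quadOrbits (σ : K ≃ₐ[k] K) :
    SubMulAction (Matrix.SpecialLinearGroup (Fin 2) k) (BinaryCubic k) where
  carrier := {P | ∃ q : K, q ≠ 0 ∧ σ q = -q ∧ algebraMap k K P.Qn = q ^ 2}
  smul_mem' g P h := by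
    simpa only [Set.mem_ofPred_eq, Qn_smul] using h

/-- The cubics over `k` of the form `T + T̄` with `T` a nonzero multiple of a cube over `K` and
`T`, `T̄` coprime. -/
def conjSums (σ : K ≃ₐ[k] K) : Set (BinaryCubic k) :=
  {P | ∃ T ∈ tripleRoot K, P.map (algebraMap k K) = T + T.map (σ : K →+* K) ∧
    Coprime T (T.map (σ : K →+* K))}

/-- The conjugation induced by `σ` on `K*/K*³`. -/
def conjClass (σ : K ≃ₐ[k] K) : CubeClass K →* CubeClass K :=
  QuotientGroup.map (cubes K) (cubes K) (Units.map (σ : K →* K)) (by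
    rintro _ ⟨u, rfl⟩
    exact ⟨Units.map (σ : K →* K) u, by simp⟩)

/-- The unitary group `U(K*/K*³) = {s : s s̄ = 1}`. -/
def unitaryClasses (σ : K ≃ₐ[k] K) : Subgroup (CubeClass K) :=
  (MonoidHom.id (CubeClass K) * conjClass σ).ker

theorem mem_unitaryClasses (σ : K ≃ₐ[k] K) (s : CubeClass K) :
    s ∈ unitaryClasses σ ↔ s * conjClass σ s = 1 := Iff.rfl

theorem conjClass_mk (σ : K ≃ₐ[k] K) (u : Kˣ) :
    conjClass σ (CubeClass.mk u) = CubeClass.mk (Units.map (σ : K →* K) u) := rfl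

/-- The space `Im K* ×_{Z₂} U(K*/K*³)`: the classes in `K* ×_{Z₂} K*/K*³` of the elements of the
`Z₂`-stable subset `Im K* × U(K*/K*³)`, where `Im K* = {q ∈ K* : q̄ = -q}`. -/
def unitaryParam (σ : K ≃ₐ[k] K) : Set (OrbitParam K) :=
  {x | ∃ (q : Kˣ) (s : CubeClass K), σ (q : K) = -(q : K) ∧ s ∈ unitaryClasses σ ∧
    x = OrbitParam.mk q s}

/-- The group of matrices `diag(l, l̄)` in `SL(2, K)` with `l³ = 1` and `l l̄ = 1`. -/
def diagGroup (σ : K ≃ₐ[k] K) : Subgroup (Matrix.SpecialLinearGroup (Fin 2) K) where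
  carrier := {g | ∃ l : K, g.1 = !![l, 0; 0, σ l] ∧ l ^ 3 = 1 ∧ l * σ l = 1}
  one_mem' := ⟨1, by simp [Matrix.one_fin_two], by simp, by simp⟩
  mul_mem' := by
    rintro g h ⟨l, hg, h3, h1⟩ ⟨m, hh, m3, m1⟩
    refine ⟨l * m, ?_, by rw [mul_pow, h3, m3, one_mul], ?_⟩
    · rw [Matrix.SpecialLinearGroup.coe_mul, hg, hh]
      simp
    · rw [map_mul, mul_mul_mul_comm, h1, m1, one_mul]
  inv_mem' := by
    rintro g ⟨l, hg, h3, h1⟩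
    have h2 : σ l * σ (σ l) = 1 := by rw [← map_mul, h1, map_one]
    have h0 : σ l ≠ 0 := right_ne_zero_of_mul_eq_one h1
    have hss : σ (σ l) = l := mul_left_cancel₀ h0 (by rw [h2, mul_comm, h1])
    refine ⟨σ l, ?_, by rw [← map_pow, h3, map_one], h2⟩
    rw [Matrix.SpecialLinearGroup.coe_inv, hg, Matrix.adjugate_fin_two_of, hss]
    simp

end Quadratic

end BinaryCubic

/-! The engine is the cubic covariant `J`. If `P = T₁ + T₂` with `T₁`, `T₂` multiples of cubes and
`q = ω(T₁, T₂)`, then `Q_n(P) = q²` and `J(P) = q (T₁ - T₂)`. When `q ≠ 0`, `T₁ = (P + J(P)/q)/2`,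
so the decomposition is determined by the choice of the square root `q`, and the other root swaps
the summands. This swap is the involution `(q, s) ↦ (-q, s⁻¹)`, hence the invariant is well defined.
Conversely, if `Q_n(P) = q² ≠ 0`, the same formula produces multiples of cubes
(`exists_summand_eq`). If `P` is defined over `k` and `q̄ = -q`, conjugation exchanges them, so `P =
T + T̄` (`exists_isConjSum`).

For `T = l φ³`, the determinant `D = det(φ, φ̄)` is nonzero and `ω(T, T̄) = l l̄ D³`. The group
`SL(2, k)` acts transitively on forms with a given `D ≠ 0`, since the matrix carrying `φ, φ̄` to
`φ', φ̄'` is fixed by conjugation (`exists_formAct_eq`). Equality of invariants makes `l / l'` a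
cube, which reduces the separation of orbits to this transitivity (`exists_smul_scale_cube_eq`).
Every admissible value is attained by an explicit `T` (`exists_orbitInvariant_eq`). An element
fixing `P` fixes `T`, so it multiplies `φ` by a cube root of unity of norm one, and this scalar
determines it. -/

namespace BinaryCubic

/-! ### Linear forms, the cubic covariant and splitting into two cubes. -/

section Forms

variable {F L : Type*} [Field F] [Field L]

/-- The determinant of a pair of linear forms. -/
def formDet (φ ψ : Fin 2 → F) : F := φ 0 * ψ 1 - φ 1 * ψ 0

/-- The substitution action of `SL(2, F)` on linear forms. -/
def formAct (g : Matrix.SpecialLinearGroup (Fin 2) F) (φ : Fin 2 → F) : Fin 2 → F :=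
  ![φ 0 * g.1 1 1 - φ 1 * g.1 1 0, -φ 0 * g.1 0 1 + φ 1 * g.1 0 0]

/-- The cubic covariant of a binary cubic. -/
def covariant (P : BinaryCubic F) : BinaryCubic F :=
  ⟨P.a ^ 2 * P.d - 3 * P.a * P.b * P.c + 2 * P.b ^ 3,
   P.a * P.b * P.d + P.b ^ 2 * P.c - 2 * P.a * P.c ^ 2,
   -(P.a * P.c * P.d) - P.b * P.c ^ 2 + 2 * P.b ^ 2 * P.d,
   -(P.a * P.d ^ 2) + 3 * P.b * P.c * P.d - 2 * P.c ^ 3⟩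

/-- The summand `(P + J(P) / q) / 2` of `P`, where `J` is the cubic covariant. -/
def summand (P : BinaryCubic F) (q : F) : BinaryCubic F :=
  scale (1 / 2) (P + scale (1 / q) P.covariant)

@[simp] theorem add_a (P R : BinaryCubic F) : (P + R).a = P.a + R.a := rfl
@[simp] theorem add_b (P R : BinaryCubic F) : (P + R).b = P.b + R.b := rfl
@[simp] theorem add_c (P R : BinaryCubic F) : (P + R).c = P.c + R.c := rfl
@[simp] theorem add_d (P R : BinaryCubic F) : (P + R).d = P.d + R.d := rfl

protected theorem add_comm (P R : BinaryCubic F) : P + R = R + P := by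
  ext <;> simp [add_comm]

theorem omega_scale_cube (l m : F) (φ ψ : Fin 2 → F) :
    omega (scale l (cube φ)) (scale m (cube ψ)) = l * m * formDet φ ψ ^ 3 := by
  simp only [omega, scale, cube, formDet]
  ring

theorem omega_swap (P R : BinaryCubic F) : omega R P = -omega P R := by
  simp only [omega]; ring

theorem Qn_cube_sum (l m : F) (φ ψ : Fin 2 → F) :
    (scale l (cube φ) + scale m (cube ψ)).Qn =
      omega (scale l (cube φ)) (scale m (cube ψ)) ^ 2 := by
  simp only [Qn_eq, omega, scale, cube, add_a, add_b, add_c, add_d]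
  ring

theorem summand_cube_sum (h2 : (2 : F) ≠ 0) (l m : F) (φ ψ : Fin 2 → F)
    (h : omega (scale l (cube φ)) (scale m (cube ψ)) ≠ 0) :
    summand (scale l (cube φ) + scale m (cube ψ))
      (omega (scale l (cube φ)) (scale m (cube ψ))) = scale l (cube φ) := by
  rw [omega_scale_cube] at *
  -- The covariant of `T₁ + T₂` is `q (T₁ - T₂)`, so adding `J/q` to the cubic cancels `T₂` and
  -- doubles `T₁`.
  have hJ : (scale l (cube φ) + scale m (cube ψ)).covariant =
      scale (l * m * formDet φ ψ ^ 3) (scale l (cube φ) + scale (-m) (cube ψ)) := by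
    ext <;> simp only [covariant, formDet, scale, cube, add_a, add_b, add_c, add_d] <;> ring
  rw [summand, hJ]
  generalize l * m * formDet φ ψ ^ 3 = q at h
  ext <;> simp only [scale, cube, add_a, add_b, add_c, add_d] <;> field_simp <;> ring

theorem summand_add_summand_neg (h2 : (2 : F) ≠ 0) (P : BinaryCubic F) (q : F) :
    summand P q + summand P (-q) = P := by
  ext <;> simp only [summand, scale, add_a, add_b, add_c, add_d, div_neg] <;> field_simp <;> ring

theorem omega_summand (h2 : (2 : F) ≠ 0) (P : BinaryCubic F) {q : F} (hq : q ≠ 0)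
    (h : P.Qn = q ^ 2) : omega (summand P q) (summand P (-q)) = q := by
  -- As `ω` is alternating, only the cross terms between `P` and its covariant survive.
  have h' : omega P P.covariant = -2 * P.Qn := by
    simp only [omega, covariant, Qn_eq]; ring
  have : omega (summand P q) (summand P (-q)) = -(1 / (2 * q)) * omega P P.covariant := by
    simp only [omega, summand, scale, add_a, add_b, add_c, add_d]
    field_simp
    ring
  rw [this, h', h]
  field_simp

/-- The hypotheses are the vanishing of the Hessian: the coefficients form a geometric progression,
of ratio `b / a` if `a ≠ 0`; if `a = 0`, only `d y³` is left. -/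
theorem exists_eq_scale_cube {T : BinaryCubic F} (h₁ : T.b ^ 2 = T.a * T.c)
    (h₂ : T.b * T.c = T.a * T.d) (h₃ : T.c ^ 2 = T.b * T.d) :
    ∃ (l : F) (φ : Fin 2 → F), T = scale l (cube φ) := by
  by_cases ha : T.a = 0
  · have hb : T.b = 0 := by simpa [ha] using h₁
    have hc : T.c = 0 := by simpa [hb] using h₃
    exact ⟨T.d, ![0, 1], by ext <;> simp [scale, cube, ha, hb, hc]⟩
  · refine ⟨T.a, ![1, T.b / T.a], ?_⟩
    ext <;> simp only [scale, cube, Matrix.cons_val_zero, Matrix.cons_val_one] <;> field_simp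
    · linear_combination -h₁
    · linear_combination (-T.a) * h₂ - T.b * h₁

/-- Each Hessian coefficient of the summand is the corresponding one of `P` times a multiple of
`Q_n(P) - q²`, so it vanishes. -/
theorem exists_summand_eq (h2 : (2 : F) ≠ 0) (P : BinaryCubic F) {q : F} (hq : q ≠ 0)
    (h : P.Qn = q ^ 2) : ∃ (l : F) (φ : Fin 2 → F), summand P q = scale l (cube φ) := by
  rw [Qn_eq] at h
  apply exists_eq_scale_cube <;>
    simp only [summand, covariant, scale, add_a, add_b, add_c, add_d] <;> field_simp
  · linear_combination (-1 : F) * (P.b ^ 2 - P.a * P.c) * h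
  · linear_combination (-1 : F) * (P.b * P.c - P.a * P.d) * h
  · linear_combination (-1 : F) * (P.c ^ 2 - P.b * P.d) * h

theorem exists_smul_eq_of_cube_eq {φ ψ : Fin 2 → F} (hφ : φ ≠ 0) (h : cube φ = cube ψ) :
    ∃ z : F, z ^ 3 = 1 ∧ ψ = z • φ := by
  simp only [cube, BinaryCubic.mk.injEq] at h
  obtain ⟨ha, hb, hc, hd⟩ := h
  by_cases h0 : φ 0 = 0
  · have h1 : φ 1 ≠ 0 := fun h1 => hφ (by ext i; fin_cases i <;> simpa)
    have h0' : ψ 0 = 0 := by simpa [h0] using ha.symm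
    refine ⟨ψ 1 / φ 1, by rw [div_pow, ← hd]; field_simp, ?_⟩
    ext i; fin_cases i
    · simp [h0, h0']
    · simp [h1]
  · have h0' : ψ 0 ≠ 0 := fun h => h0 (by simpa [h] using ha)
    refine ⟨ψ 0 / φ 0, by rw [div_pow, ← ha]; field_simp, ?_⟩
    ext i; fin_cases i
    · simp [h0]
    · simp only [Pi.smul_apply, smul_eq_mul, Fin.mk_one]
      field_simp
      apply mul_left_cancel₀ (pow_ne_zero 2 h0')
      linear_combination φ 0 * (-hb) + φ 1 * ha

theorem scale_cube_smul (l z : F) (φ : Fin 2 → F) :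
    scale l (cube (z • φ)) = scale (l * z ^ 3) (cube φ) := by
  ext <;> simp only [scale, cube, Pi.smul_apply, smul_eq_mul] <;> ring

theorem formDet_ne_zero_left {φ ψ : Fin 2 → F} (h : formDet φ ψ ≠ 0) : φ ≠ 0 := by
  rintro rfl; simp [formDet] at h

theorem scale_injective {l : F} (hl : l ≠ 0) {P R : BinaryCubic F}
    (h : scale l P = scale l R) : P = R := by
  simpa [scale, hl, BinaryCubic.ext_iff] using h

/-! ### Classes modulo cubes and coprimality. -/

theorem mk_eq_mk_iff {u v : Fˣ} :
    CubeClass.mk u = CubeClass.mk v ↔ ∃ c : Fˣ, u * c ^ 3 = v := by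
  refine QuotientGroup.eq.trans ⟨?_, ?_⟩
  · rintro ⟨c, hc⟩
    exact ⟨c, by rw [show c ^ 3 = u⁻¹ * v from hc]; simp⟩
  · rintro ⟨c, hc⟩
    exact ⟨c, by rw [← hc]; simp⟩

/-- At an index where `φ` does not vanish, the ratio of the coefficients of the two forms is a cube
root of `m / l`. -/
theorem mk_eq_of_scale_cube_eq {l m : Fˣ} {φ ψ : Fin 2 → F} (hφ : φ ≠ 0)
    (h : scale (l : F) (cube φ) = scale (m : F) (cube ψ)) : CubeClass.mk l = CubeClass.mk m := by
  have key : ∀ i, (l : F) * φ i ^ 3 = m * ψ i ^ 3 := by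
    simp only [scale, cube, BinaryCubic.mk.injEq] at h
    intro i; fin_cases i
    · exact h.1
    · exact h.2.2.2
  obtain ⟨i, hi⟩ := Function.ne_iff.mp hφ
  have hi : φ i ≠ 0 := hi
  have hψ : ψ i ≠ 0 := fun h0 => by
    have := key i
    simp [h0, hi] at this
  rw [mk_eq_mk_iff]
  refine ⟨Units.mk0 (φ i / ψ i) (div_ne_zero hi hψ), ?_⟩
  ext
  simp only [Units.val_mul, Units.val_pow_eq_pow_val, Units.val_mk0]
  have := key i
  field_simp
  linear_combination this

theorem isRelPrime_X_zero_X_one :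
    IsRelPrime (MvPolynomial.X 0 : MvPolynomial (Fin 2) F) (MvPolynomial.X 1) := by
  have h0 : Irreducible (MvPolynomial.X 0 : MvPolynomial (Fin 2) F) :=
    (MvPolynomial.X_prime (i := 0)).irreducible
  rw [h0.isRelPrime_iff_not_dvd]
  rintro ⟨p, hp⟩
  have := congrArg (MvPolynomial.eval ![0, 1]) hp
  simp at this

theorem not_isUnit_linear (φ : Fin 2 → F) :
    ¬ IsUnit (MvPolynomial.C (φ 0) * MvPolynomial.X 0
      + MvPolynomial.C (φ 1) * MvPolynomial.X 1 : MvPolynomial (Fin 2) F) := by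
  intro h
  -- A linear form vanishes at the origin, whereas a unit cannot.
  have := h.map (MvPolynomial.eval (0 : Fin 2 → F))
  simp at this

theorem coprime_scale_cube_iff {l m : F} (hl : l ≠ 0) (hm : m ≠ 0) (φ ψ : Fin 2 → F) :
    Coprime (scale l (cube φ)) (scale m (cube ψ)) ↔ formDet φ ψ ≠ 0 := by
  rw [Coprime, toPoly_scale_cube, toPoly_scale_cube]
  have ul : IsUnit (MvPolynomial.C l : MvPolynomial (Fin 2) F) := hl.isUnit.map _
  have um : IsUnit (MvPolynomial.C m : MvPolynomial (Fin 2) F) := hm.isUnit.map _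
  rw [isRelPrime_mul_unit_left_left ul, isRelPrime_mul_unit_left_right um]
  constructor
  · intro h hD
    have hD : φ 0 * ψ 1 = φ 1 * ψ 0 := sub_eq_zero.mp hD
    by_cases hφ : φ = 0
    · subst hφ
      -- If `φ = 0`, the cube of `ψ` is itself a common divisor.
      exact not_isUnit_linear ψ ((isUnit_pow_iff three_ne_zero).mp (h (by simp) dvd_rfl))
    · obtain ⟨c, rfl⟩ : ∃ c : F, ψ = c • φ := by
        by_cases h0 : φ 0 = 0
        · have h1 : φ 1 ≠ 0 := fun h1 => hφ (by ext i; fin_cases i <;> simpa)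
          refine ⟨ψ 1 / φ 1, ?_⟩
          have : ψ 0 = 0 := by simpa [h0, h1] using hD
          ext i; fin_cases i
          · simp [h0, this]
          · simp [h1]
        · refine ⟨ψ 0 / φ 0, ?_⟩
          ext i; fin_cases i
          · simp [h0]
          · simp only [Pi.smul_apply, smul_eq_mul, Fin.mk_one]
            field_simp
            linear_combination hD
      refine not_isUnit_linear φ (h (dvd_pow_self _ three_ne_zero) (Dvd.dvd.trans ?_
        (dvd_pow_self _ three_ne_zero)))
      refine ⟨MvPolynomial.C c, ?_⟩
      simp only [Pi.smul_apply, smul_eq_mul, map_mul]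
      ring
  · intro hD
    apply IsRelPrime.pow
    intro p h1 h2
    have uD : IsUnit (MvPolynomial.C (formDet φ ψ) : MvPolynomial (Fin 2) F) := hD.isUnit.map _
    -- By Cramer's rule `D x` and `D y` are combinations of the two forms, so a common divisor of
    -- the forms divides `x` and `y`.
    apply isRelPrime_X_zero_X_one (F := F)
    · rw [← uD.dvd_mul_left]
      convert dvd_sub (h1.mul_left (MvPolynomial.C (ψ 1))) (h2.mul_left (MvPolynomial.C (φ 1)))
        using 1
      simp only [formDet, map_sub, map_mul]
      ring
    · rw [← uD.dvd_mul_left]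
      convert dvd_sub (h2.mul_left (MvPolynomial.C (φ 0))) (h1.mul_left (MvPolynomial.C (ψ 0)))
        using 1
      simp only [formDet, map_sub, map_mul]
      ring

/-! ### Uniqueness of the decomposition and the invariant. -/

theorem isCubeSum_iff {P : BinaryCubic F} {l m : Fˣ} {φ ψ : Fin 2 → F} :
    IsCubeSum P l m φ ψ ↔
      P = scale (l : F) (cube φ) + scale (m : F) (cube ψ) ∧ formDet φ ψ ≠ 0 := by
  rw [IsCubeSum, coprime_scale_cube_iff l.ne_zero m.ne_zero]

theorem IsCubeSum.omega_ne_zero {P : BinaryCubic F} {l m : Fˣ} {φ ψ : Fin 2 → F}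
    (h : IsCubeSum P l m φ ψ) : omega (scale (l : F) (cube φ)) (scale (m : F) (cube ψ)) ≠ 0 := by
  rw [omega_scale_cube]
  exact mul_ne_zero (mul_ne_zero l.ne_zero m.ne_zero) (pow_ne_zero 3 (isCubeSum_iff.mp h).2)

theorem IsCubeSum.symm {P : BinaryCubic F} {l m : Fˣ} {φ ψ : Fin 2 → F}
    (h : IsCubeSum P l m φ ψ) : IsCubeSum P m l ψ φ :=
  ⟨h.1.trans (BinaryCubic.add_comm _ _), IsRelPrime.symm h.2⟩

theorem IsCubeSum.summand_eq (h2 : (2 : F) ≠ 0) {P : BinaryCubic F} {l m : Fˣ}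
    {φ ψ : Fin 2 → F} (h : IsCubeSum P l m φ ψ) :
    summand P (omega (scale (l : F) (cube φ)) (scale (m : F) (cube ψ))) =
      scale (l : F) (cube φ) := by
  conv_lhs => rw [h.1]
  exact summand_cube_sum h2 _ _ _ _ h.omega_ne_zero

theorem OrbitParam.mk_eq_mk_iff {q q' : Fˣ} {s s' : CubeClass F} :
    OrbitParam.mk q s = OrbitParam.mk q' s' ↔ (q' = q ∧ s' = s) ∨ (q' = -q ∧ s' = s⁻¹) := by
  refine Quotient.eq.trans ?_
  change (q', s') = (q, s) ∨ (q', s') = (-q, s⁻¹) ↔ _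
  simp only [Prod.mk.injEq]

/-- Decompositions with the same value of `ω` have proportional coefficients modulo cubes. -/
theorem IsCubeSum.class_eq (h2 : (2 : F) ≠ 0) {P : BinaryCubic F} {l m l' m' : Fˣ}
    {φ ψ φ' ψ' : Fin 2 → F} (h : IsCubeSum P l m φ ψ) (h' : IsCubeSum P l' m' φ' ψ')
    (hq : omega (scale (l' : F) (cube φ')) (scale (m' : F) (cube ψ')) =
      omega (scale (l : F) (cube φ)) (scale (m : F) (cube ψ))) :
    CubeClass.mk l' * (CubeClass.mk m')⁻¹ = CubeClass.mk l * (CubeClass.mk m)⁻¹ := by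
  -- Both summands are recovered from `P` and the value of `ω`, so they coincide term by term.
  have e₁ : scale (l : F) (cube φ) = scale (l' : F) (cube φ') := by
    rw [← h.summand_eq h2, ← h'.summand_eq h2, hq]
  have e₂ : scale (m : F) (cube ψ) = scale (m' : F) (cube ψ') := by
    rw [← h.symm.summand_eq h2, ← h'.symm.summand_eq h2, omega_swap (scale (l : F) (cube φ)),
      omega_swap (scale (l' : F) (cube φ')), hq]
  rw [mk_eq_of_scale_cube_eq (formDet_ne_zero_left (isCubeSum_iff.mp h).2) e₁,
    mk_eq_of_scale_cube_eq (formDet_ne_zero_left (isCubeSum_iff.mp h.symm).2) e₂]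

theorem IsCubeSum.orbitInvariant_eq (h2 : (2 : F) ≠ 0) {P : BinaryCubic F} {l m : Fˣ}
    {φ ψ : Fin 2 → F} (h : IsCubeSum P l m φ ψ) {q : Fˣ}
    (hq : (q : F) = omega (scale (l : F) (cube φ)) (scale (m : F) (cube ψ))) :
    orbitInvariant P = OrbitParam.mk q (CubeClass.mk l * (CubeClass.mk m)⁻¹) := by
  -- The given decomposition shows that the choice is not the default value.
  have hx : IsInvariantValue P (orbitInvariant P) :=
    Classical.epsilon_spec (p := IsInvariantValue P) ⟨_, l, m, φ, ψ, q, h, hq, rfl⟩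
  obtain ⟨l', m', φ', ψ', q', h', hq', hx⟩ := hx
  rw [hx, OrbitParam.mk_eq_mk_iff]
  -- Both values are square roots of `Q_n(P)`; opposite signs amount to swapping the summands.
  have hsq : (q : F) ^ 2 = (q' : F) ^ 2 := by
    rw [hq, hq', ← Qn_cube_sum, ← Qn_cube_sum, ← h.1, ← h'.1]
  rcases sq_eq_sq_iff_eq_or_eq_neg.mp hsq with e | e
  · exact Or.inl ⟨Units.ext e, h'.class_eq h2 h (by rw [← hq, ← hq', e])⟩
  · refine Or.inr ⟨Units.ext e, ?_⟩
    rw [h'.symm.class_eq h2 h (by rw [omega_swap (scale (l' : F) _), ← hq, ← hq', e])]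
    simp

/-! ### The action on linear forms, and base change. -/

theorem smul_add_cubic (g : Matrix.SpecialLinearGroup (Fin 2) F) (P R : BinaryCubic F) :
    g • (P + R) = g • P + g • R := by
  ext <;> simp only [HSMul.hSMul, SMul.smul, add_a, add_b, add_c, add_d] <;> ring

theorem smul_scale_cube (g : Matrix.SpecialLinearGroup (Fin 2) F) (l : F) (φ : Fin 2 → F) :
    g • scale l (cube φ) = scale l (cube (formAct g φ)) := by
  ext <;> simp only [HSMul.hSMul, SMul.smul, scale, cube, formAct, Matrix.cons_val_zero,
    Matrix.cons_val_one] <;> ring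

theorem formDet_formAct (g : Matrix.SpecialLinearGroup (Fin 2) F) (φ ψ : Fin 2 → F) :
    formDet (formAct g φ) (formAct g ψ) = formDet φ ψ := by
  have hg : g.1 0 0 * g.1 1 1 - g.1 0 1 * g.1 1 0 = 1 := by
    rw [← Matrix.det_fin_two]; exact g.2
  simp only [formDet, formAct, Matrix.cons_val_zero, Matrix.cons_val_one]
  linear_combination (φ 0 * ψ 1 - φ 1 * ψ 0) * hg

theorem formAct_mul (g h : Matrix.SpecialLinearGroup (Fin 2) F) (φ : Fin 2 → F) :
    formAct (g * h) φ = formAct g (formAct h φ) := by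
  ext i; fin_cases i <;>
  · simp [formAct, Matrix.SpecialLinearGroup.coe_mul, Matrix.mul_apply, Fin.sum_univ_two]
    ring

theorem formAct_smul (g : Matrix.SpecialLinearGroup (Fin 2) F) (z : F) (φ : Fin 2 → F) :
    formAct g (z • φ) = z • formAct g φ := by
  ext i; fin_cases i <;>
  · simp [formAct]
    ring

theorem formDet_smul (z w : F) (φ ψ : Fin 2 → F) :
    formDet (z • φ) (w • ψ) = z * w * formDet φ ψ := by
  simp only [formDet, Pi.smul_apply, smul_eq_mul]; ring

/-- An element of `SL(2, F)` fixing two independent linear forms is trivial. -/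
theorem eq_one_of_formAct_eq {g : Matrix.SpecialLinearGroup (Fin 2) F} {φ ψ : Fin 2 → F}
    (hD : formDet φ ψ ≠ 0) (h₁ : formAct g φ = φ) (h₂ : formAct g ψ = ψ) : g = 1 := by
  have a0 := congrFun h₁ 0
  have a1 := congrFun h₁ 1
  have b0 := congrFun h₂ 0
  have b1 := congrFun h₂ 1
  simp only [formAct, Matrix.cons_val_zero, Matrix.cons_val_one] at a0 a1 b0 b1
  have e00 : g.1 0 0 = 1 := by
    apply mul_left_cancel₀ hD; simp only [formDet]; linear_combination φ 0 * b1 - ψ 0 * a1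
  have e01 : g.1 0 1 = 0 := by
    apply mul_left_cancel₀ hD; simp only [formDet]; linear_combination φ 1 * b1 - ψ 1 * a1
  have e10 : g.1 1 0 = 0 := by
    apply mul_left_cancel₀ hD; simp only [formDet]; linear_combination ψ 0 * a0 - φ 0 * b0
  have e11 : g.1 1 1 = 1 := by
    apply mul_left_cancel₀ hD; simp only [formDet]; linear_combination ψ 1 * a0 - φ 1 * b0
  ext i j; fin_cases i <;> fin_cases j <;> simp [e00, e01, e10, e11]

theorem map_smul_cubic (f : F →+* L) (g : Matrix.SpecialLinearGroup (Fin 2) F)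
    (P : BinaryCubic F) :
    (g • P).map f = Matrix.SpecialLinearGroup.map f g • P.map f := by
  ext <;> simp [HSMul.hSMul, SMul.smul, map, map_ofNat]

theorem map_injective (f : F →+* L) : Function.Injective (map f) := by
  intro P R h
  simp only [map, BinaryCubic.mk.injEq] at h
  ext
  exacts [f.injective h.1, f.injective h.2.1, f.injective h.2.2.1, f.injective h.2.2.2]

theorem map_Qn (f : F →+* L) (P : BinaryCubic F) : (P.map f).Qn = f P.Qn := by
  simp [Qn_eq, map, map_ofNat]

theorem map_scale_cube (f : F →+* L) (l : F) (φ : Fin 2 → F) :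
    (scale l (cube φ)).map f = scale (f l) (cube (f ∘ φ)) := by
  ext <;> simp [map, scale, cube]

end Forms

end BinaryCubic

namespace BinaryCubic

/-! ### Conjugation in the quadratic extension. -/

section Conjugation

variable {k K : Type*} [Field k] [Field K] [Algebra k K]

theorem conj_conj (hK : Module.finrank k K = 2) {σ : K ≃ₐ[k] K} (hσ : σ ≠ 1) (x : K) :
    σ (σ x) = x := by
  have : FiniteDimensional k K := .of_finrank_pos (by omega)
  have hcard : Fintype.card (K ≃ₐ[k] K) = 2 := by
    apply le_antisymm (hK ▸ AlgEquiv.card_le)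
    exact Fintype.one_lt_card_iff.mpr ⟨σ, 1, hσ⟩
  have h : σ ^ 2 = 1 := hcard ▸ pow_card_eq_one
  rw [pow_two] at h
  exact DFunLike.congr_fun h x

theorem subalgebra_eq_bot_or_top (hK : Module.finrank k K = 2) (S : Subalgebra k K) :
    S = ⊥ ∨ S = ⊤ :=
  have := Subalgebra.isSimpleOrder_of_finrank hK
  eq_bot_or_eq_top S

/-- The fixed elements form a subalgebra other than `K`, and in degree two it can only be `k`. -/
theorem exists_algebraMap_eq (hK : Module.finrank k K = 2) {σ : K ≃ₐ[k] K} (hσ : σ ≠ 1) {x : K}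
    (hx : σ x = x) : ∃ y : k, algebraMap k K y = x := by
  have hmem : x ∈ AlgHom.equalizer (σ : K →ₐ[k] K) (AlgHom.id k K) := hx
  rcases subalgebra_eq_bot_or_top hK (AlgHom.equalizer (σ : K →ₐ[k] K) (AlgHom.id k K)) with h | h
  · rw [h] at hmem
    exact Algebra.mem_bot.mp hmem
  · refine absurd (AlgEquiv.ext fun y => ?_) hσ
    have : y ∈ AlgHom.equalizer (σ : K →ₐ[k] K) (AlgHom.id k K) := h ▸ Algebra.mem_top
    exact this

/-- Conjugation of the coefficients of a linear form. -/
abbrev conjForm (σ : K ≃ₐ[k] K) (φ : Fin 2 → K) : Fin 2 → K := (σ : K →+* K) ∘ φ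

/-- Conjugation of the units of `K`. -/
abbrev conjUnit (σ : K ≃ₐ[k] K) (l : Kˣ) : Kˣ := Units.map (σ : K →* K) l

theorem conjForm_conjForm {σ : K ≃ₐ[k] K} (hσσ : ∀ x, σ (σ x) = x) (φ : Fin 2 → K) :
    conjForm σ (conjForm σ φ) = φ := by
  ext i; simp [hσσ]

theorem conj_formDet {σ : K ≃ₐ[k] K} (hσσ : ∀ x, σ (σ x) = x) (φ : Fin 2 → K) :
    σ (formDet φ (conjForm σ φ)) = -formDet φ (conjForm σ φ) := by
  simp only [formDet, Function.comp_apply, map_sub, map_mul, RingHom.coe_coe, hσσ]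
  ring

theorem conjForm_smul (σ : K ≃ₐ[k] K) (z : K) (φ : Fin 2 → K) :
    conjForm σ (z • φ) = σ z • conjForm σ φ := by
  ext i; simp

theorem formAct_conjForm (σ : K ≃ₐ[k] K) (g : Matrix.SpecialLinearGroup (Fin 2) k)
    (φ : Fin 2 → K) :
    formAct (Matrix.SpecialLinearGroup.map (algebraMap k K) g) (conjForm σ φ) =
      conjForm σ (formAct (Matrix.SpecialLinearGroup.map (algebraMap k K) g) φ) := by
  ext i; fin_cases i <;> simp [formAct]

/-- `P` is the sum of `l φ³` and its conjugate, and these are coprime. -/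
def IsConjSum (σ : K ≃ₐ[k] K) (P : BinaryCubic k) (l : Kˣ) (φ : Fin 2 → K) : Prop :=
  IsCubeSum (P.map (algebraMap k K)) l (conjUnit σ l) φ (conjForm σ φ)

theorem isConjSum_iff {σ : K ≃ₐ[k] K} {P : BinaryCubic k} {l : Kˣ} {φ : Fin 2 → K} :
    IsConjSum σ P l φ ↔ P.map (algebraMap k K) = scale (l : K) (cube φ) +
      scale (σ l) (cube (conjForm σ φ)) ∧ formDet φ (conjForm σ φ) ≠ 0 :=
  isCubeSum_iff

theorem IsConjSum.conj {σ : K ≃ₐ[k] K} (hσσ : ∀ x, σ (σ x) = x) {P : BinaryCubic k} {l : Kˣ}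
    {φ : Fin 2 → K} (h : IsConjSum σ P l φ) :
    IsConjSum σ P (conjUnit σ l) (conjForm σ φ) := by
  have hl : conjUnit σ (conjUnit σ l) = l := Units.ext (hσσ l)
  rw [IsConjSum, hl, conjForm_conjForm hσσ]
  exact IsCubeSum.symm h

/-! ### The descriptions of the set of cubics. -/

theorem mem_quadOrbits_iff {σ : K ≃ₐ[k] K} {P : BinaryCubic k} :
    P ∈ quadOrbits σ ↔ ∃ q : K, q ≠ 0 ∧ σ q = -q ∧ algebraMap k K P.Qn = q ^ 2 := Iff.rfl

theorem conj_omega {σ : K ≃ₐ[k] K} (hσσ : ∀ x, σ (σ x) = x) (l : K) (φ : Fin 2 → K) :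
    σ (omega (scale l (cube φ)) (scale (σ l) (cube (conjForm σ φ)))) =
      -omega (scale l (cube φ)) (scale (σ l) (cube (conjForm σ φ))) := by
  simp only [omega_scale_cube, map_mul, map_pow, hσσ, conj_formDet hσσ]
  ring

theorem IsConjSum.mem_quadOrbits {σ : K ≃ₐ[k] K} (hσσ : ∀ x, σ (σ x) = x) {P : BinaryCubic k}
    {l : Kˣ} {φ : Fin 2 → K} (h : IsConjSum σ P l φ) : P ∈ quadOrbits σ :=
  mem_quadOrbits_iff.mpr ⟨_, h.omega_ne_zero, conj_omega hσσ l φ, by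
    rw [← Qn_cube_sum, ← h.1, map_Qn]⟩

theorem exists_isConjSum (h2 : (2 : K) ≠ 0) {σ : K ≃ₐ[k] K} {P : BinaryCubic k}
    (hP : P ∈ quadOrbits σ) : ∃ (l : Kˣ) (φ : Fin 2 → K), IsConjSum σ P l φ := by
  obtain ⟨q, hq, hσq, hQ⟩ := mem_quadOrbits_iff.mp hP
  rw [← map_Qn] at hQ
  obtain ⟨l, φ, hT⟩ := exists_summand_eq h2 _ hq hQ
  -- The covariant of `P` has coefficients in `k` and `q̄ = -q`, so conjugating one summand gives
  -- the other.
  have hT' : summand (P.map (algebraMap k K)) (-q) = scale (σ l) (cube (conjForm σ φ)) := by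
    have := map_scale_cube (σ : K →+* K) l φ
    rw [← hT] at this
    refine Eq.trans ?_ this
    ext <;> simp [summand, map, scale, covariant, hσq, map_ofNat, div_neg]
  have hω := omega_summand h2 _ hq hQ
  rw [hT, hT', omega_scale_cube] at hω
  have hne := hω ▸ hq
  have hl : l ≠ 0 := by rintro rfl; simp at hne
  refine ⟨Units.mk0 l hl, φ, isConjSum_iff.mpr ⟨?_, ?_⟩⟩
  · rw [Units.val_mk0, ← hT', ← hT, summand_add_summand_neg h2]
  · intro h0; simp [h0] at hne

theorem coe_quadOrbits_eq_conjSums (h2 : (2 : K) ≠ 0) {σ : K ≃ₐ[k] K}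
    (hσσ : ∀ x, σ (σ x) = x) : (quadOrbits σ : Set (BinaryCubic k)) = conjSums σ := by
  ext P
  constructor
  · intro hP
    obtain ⟨l, φ, h⟩ := exists_isConjSum h2 hP
    refine ⟨scale (l : K) (cube φ), ⟨fun h0 => h.omega_ne_zero ?_, l, φ, rfl⟩, ?_⟩
    · rw [h0]
      change (0 : K) * _ - 0 * _ - 3 * 0 * _ + 3 * 0 * _ = 0
      ring
    · rw [map_scale_cube]
      exact h
  · rintro ⟨T, ⟨hT, l, φ, rfl⟩, hP, hc⟩
    have hl : l ≠ 0 := by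
      rintro rfl
      apply hT
      ext <;> simp only [scale, zero_mul] <;> rfl
    rw [map_scale_cube] at hP hc
    exact IsConjSum.mem_quadOrbits hσσ (l := Units.mk0 l hl) (φ := φ) ⟨hP, hc⟩

theorem coe_quadOrbits_eq_isSplittingField (h2 : (2 : K) ≠ 0) (hK : Module.finrank k K = 2)
    {σ : K ≃ₐ[k] K} (hσ : σ ≠ 1) : (quadOrbits σ : Set (BinaryCubic k)) =
      {P | Polynomial.IsSplittingField k K (Polynomial.X ^ 2 - Polynomial.C P.Qn)} := by
  ext P
  have hne : (Polynomial.X ^ 2 - Polynomial.C P.Qn : Polynomial k) ≠ 0 :=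
    Polynomial.X_pow_sub_C_ne_zero two_pos _
  have hmap : (Polynomial.X ^ 2 - Polynomial.C P.Qn : Polynomial k).map (algebraMap k K) =
      Polynomial.X ^ 2 - Polynomial.C (algebraMap k K P.Qn) := by simp
  constructor
  · intro hP
    obtain ⟨q, hq, hσq, hQ⟩ := mem_quadOrbits_iff.mp hP
    have hfac : (Polynomial.X ^ 2 - Polynomial.C (algebraMap k K P.Qn) : Polynomial K) =
        (Polynomial.X - Polynomial.C q) * (Polynomial.X + Polynomial.C q) := by
      rw [hQ, map_pow]; ring
    refine ⟨?_, ?_⟩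
    · rw [hmap, hfac]
      exact (Polynomial.Splits.X_sub_C q).mul (Polynomial.Splits.X_add_C q)
    · refine (subalgebra_eq_bot_or_top hK _).resolve_left fun hbot => ?_
      have hmem : q ∈ Algebra.adjoin k
          ((Polynomial.X ^ 2 - Polynomial.C P.Qn : Polynomial k).rootSet K) := by
        apply Algebra.subset_adjoin
        rw [Polynomial.mem_rootSet]
        exact ⟨hne, by simp [hQ]⟩
      rw [hbot] at hmem
      obtain ⟨y, rfl⟩ := Algebra.mem_bot.mp hmem
      -- A root `q` in `k` would be fixed by `σ` as well as negated, forcing `2 q = 0`.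
      rw [AlgEquiv.commutes] at hσq
      have : (2 : K) * algebraMap k K y = 0 := by linear_combination hσq
      exact hq ((mul_eq_zero.mp this).resolve_left h2)
  · rintro ⟨hs, hadj⟩
    rw [hmap] at hs
    obtain ⟨q, hq⟩ := hs.exists_eval_eq_zero (by
      rw [Polynomial.degree_X_pow_sub_C two_pos]; decide)
    have hQ : algebraMap k K P.Qn = q ^ 2 := by
      simp only [Polynomial.eval_sub, Polynomial.eval_pow, Polynomial.eval_X,
        Polynomial.eval_C] at hq
      linear_combination -hq
    -- The roots are `q` and `-q` and they generate `K`: if `σ` fixed `q`, it would be trivial.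
    have hσq : σ q ≠ q := by
      intro hfix
      apply hσ
      have : (σ : K →ₐ[k] K) = AlgHom.id k K := by
        refine AlgHom.ext_of_adjoin_eq_top hadj fun x hx => ?_
        rw [Polynomial.mem_rootSet] at hx
        have hx2 : x ^ 2 = q ^ 2 := by
          have := hx.2
          simp only [map_sub, map_pow, Polynomial.aeval_X, Polynomial.aeval_C, hQ] at this
          linear_combination this
        rcases sq_eq_sq_iff_eq_or_eq_neg.mp hx2 with rfl | rfl
        · exact hfix
        · simp [hfix]
      ext x
      exact DFunLike.congr_fun this x
    have hsq : σ q ^ 2 = q ^ 2 := by rw [← map_pow, ← hQ, AlgEquiv.commutes]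
    refine mem_quadOrbits_iff.mpr ⟨q, ?_, (sq_eq_sq_iff_eq_or_eq_neg.mp hsq).resolve_left hσq, hQ⟩
    rintro rfl
    simp at hσq

/-! ### Separation of the orbits. -/

/-- Linear forms with the same nonzero value of `det(φ, φ̄)` are conjugate under `SL(2, k)`. -/
theorem exists_formAct_eq (hK : Module.finrank k K = 2) {σ : K ≃ₐ[k] K} (hσ : σ ≠ 1)
    {φ φ' : Fin 2 → K} (hD : formDet φ (conjForm σ φ) ≠ 0)
    (h : formDet φ' (conjForm σ φ') = formDet φ (conjForm σ φ)) :
    ∃ g : Matrix.SpecialLinearGroup (Fin 2) k,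
      formAct (Matrix.SpecialLinearGroup.map (algebraMap k K) g) φ = φ' := by
  have hσσ := conj_conj hK hσ
  have hσD := conj_formDet hσσ φ
  set D := formDet φ (conjForm σ φ) with hDdef
  -- The entries of the matrix sending `φ, φ̄` to `φ', φ̄'` are given by Cramer's rule. Numerators
  -- and denominator `D` all change sign under conjugation, so the quotients lie in `k`.
  have descend : ∀ x : K, σ x = -x → ∃ y : k, algebraMap k K y = x / D := fun x hx =>
    exists_algebraMap_eq hK hσ (by rw [map_div₀, hx, hσD, neg_div_neg_eq])
  obtain ⟨δ, hδ⟩ := descend (φ' 0 * σ (φ 1) - σ (φ' 0) * φ 1) (by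
    simp only [map_sub, map_mul, hσσ]; ring)
  obtain ⟨γ, hγ⟩ := descend (σ (φ 0) * φ' 0 - φ 0 * σ (φ' 0)) (by
    simp only [map_sub, map_mul, hσσ]; ring)
  obtain ⟨β, hβ⟩ := descend (σ (φ' 1) * φ 1 - φ' 1 * σ (φ 1)) (by
    simp only [map_sub, map_mul, hσσ]; ring)
  obtain ⟨α, hα⟩ := descend (φ 0 * σ (φ' 1) - σ (φ 0) * φ' 1) (by
    simp only [map_sub, map_mul, hσσ]; ring)
  have hD1 : φ 0 * σ (φ 1) - φ 1 * σ (φ 0) = D := rfl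
  have hD2 : φ' 0 * σ (φ' 1) - φ' 1 * σ (φ' 0) = D := h
  have hdet : (!![α, β; γ, δ] : Matrix (Fin 2) (Fin 2) k).det = 1 := by
    apply (algebraMap k K).injective
    rw [Matrix.det_fin_two_of, map_sub, map_mul, map_mul, hα, hβ, hγ, hδ, map_one]
    field_simp
    linear_combination D * hD1 + (φ 0 * σ (φ 1) - φ 1 * σ (φ 0)) * hD2
  refine ⟨⟨_, hdet⟩, ?_⟩
  ext i; fin_cases i
  · change φ 0 * algebraMap k K δ - φ 1 * algebraMap k K γ = φ' 0
    rw [hδ, hγ]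
    field_simp
    linear_combination φ' 0 * hD1
  · change -φ 0 * algebraMap k K β + φ 1 * algebraMap k K α = φ' 1
    rw [hα, hβ]
    field_simp
    linear_combination φ' 1 * hD1

/-- Equal classes make `(l / l̄) / (l' / l̄')` a cube, and equal values of `ω` make `l l̄ / (l'
l̄')` a cube. Their product `(l / l')²` is then a cube, hence so is `l / l'`. Absorbing its cube
root into `φ` leaves determinants that agree up to a cube root of unity. -/
theorem exists_smul_scale_cube_eq (hK : Module.finrank k K = 2) {σ : K ≃ₐ[k] K} (hσ : σ ≠ 1)
    {l l' : Kˣ} {φ φ' : Fin 2 → K} (hD : formDet φ (conjForm σ φ) ≠ 0)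
    (hω : (l : K) * σ l * formDet φ (conjForm σ φ) ^ 3 =
      (l' : K) * σ l' * formDet φ' (conjForm σ φ') ^ 3)
    (hc : CubeClass.mk l * (CubeClass.mk (conjUnit σ l))⁻¹ =
      CubeClass.mk l' * (CubeClass.mk (conjUnit σ l'))⁻¹) :
    ∃ g : Matrix.SpecialLinearGroup (Fin 2) k,
      Matrix.SpecialLinearGroup.map (algebraMap k K) g • scale (l : K) (cube φ) =
        scale (l' : K) (cube φ') := by
  have hσσ := conj_conj hK hσ
  have hl := l.ne_zero
  have hl' := l'.ne_zero
  have hσl' : σ l' ≠ 0 := by simp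
  have hD' : formDet φ' (conjForm σ φ') ≠ 0 := by
    intro h0
    rw [h0] at hω
    simp [hD] at hω
  obtain ⟨c, hc⟩ : ∃ c : Kˣ, (l' : K) * σ l * (c : K) ^ 3 = l * σ l' := by
    rw [mul_inv_eq_iff_eq_mul, mul_right_comm, ← div_eq_mul_inv, eq_div_iff_mul_eq', ← map_mul,
      ← map_mul, eq_comm, mk_eq_mk_iff] at hc
    obtain ⟨c, hc⟩ := hc
    refine ⟨c, ?_⟩
    have := congrArg Units.val hc
    simp at this
    linear_combination this
  have hσD := conj_formDet hσσ φ
  have hσD' := conj_formDet hσσ φ'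
  set D := formDet φ (conjForm σ φ)
  set D' := formDet φ' (conjForm σ φ') with hD'def
  have hcne := c.ne_zero
  -- `l / l'` is the cube of `v`
  obtain ⟨v, hv0, hv⟩ : ∃ v : K, v ≠ 0 ∧ (l : K) = l' * v ^ 3 := by
    -- Here `(c D' / D)³ = (l / l')²`, so the cube of this quotient is `l / l'`.
    refine ⟨(l / l') / (c * (D' / D)), by positivity, ?_⟩
    field_simp
    apply mul_left_cancel₀ hσl'
    linear_combination ((l : K) * D ^ 3) * hc - (l' : K) * c ^ 3 * hω
  have hσv : σ v ≠ 0 := by simpa using hv0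
  have hr3 : (v * σ v * D / D') ^ 3 = 1 := by
    have hlv : σ l = σ l' * σ v ^ 3 := by rw [hv, map_mul, map_pow]
    rw [div_pow, div_eq_one_iff_eq (pow_ne_zero 3 hD')]
    apply mul_left_cancel₀ (mul_ne_zero hl' hσl')
    rw [← hω, hlv, hv]
    ring
  have hσr : σ (v * σ v * D / D') = v * σ v * D / D' := by
    rw [map_div₀, map_mul, map_mul, hσσ, hσD, hσD']
    field_simp
  have hrD : v * σ v * D / D' * D' = v * σ v * D := div_mul_cancel₀ _ hD'
  set r := v * σ v * D / D'
  -- The discrepancy `r` satisfies `r³ = 1` and `r̄ = r`. Replacing `φ'` by `r² φ'` preserves its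
  -- cube and multiplies `D'` by `r⁴ = r`, which is the correction needed.
  obtain ⟨g, hg⟩ := exists_formAct_eq hK hσ (φ := v • φ) (φ' := r ^ 2 • φ')
    (by rw [conjForm_smul, formDet_smul]; exact mul_ne_zero (mul_ne_zero hv0 hσv) hD)
    (by
      rw [conjForm_smul, conjForm_smul, formDet_smul, formDet_smul, map_pow, hσr, ← hD'def, ← hrD]
      linear_combination r * D' * hr3)
  refine ⟨g, ?_⟩
  rw [hv, ← scale_cube_smul, smul_scale_cube, hg, scale_cube_smul, ← pow_mul, mul_comm 2 3,
    pow_mul, hr3, one_pow, mul_one]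

theorem IsConjSum.exists_unit_eq_omega {σ : K ≃ₐ[k] K} {P : BinaryCubic k} {l : Kˣ}
    {φ : Fin 2 → K} (h : IsConjSum σ P l φ) :
    ∃ q : Kˣ, (q : K) = omega (scale (l : K) (cube φ)) (scale (σ l) (cube (conjForm σ φ))) :=
  ⟨Units.mk0 _ h.omega_ne_zero, rfl⟩

theorem map_conj_smul (σ : K ≃ₐ[k] K) (g : Matrix.SpecialLinearGroup (Fin 2) k)
    (T : BinaryCubic K) :
    (Matrix.SpecialLinearGroup.map (algebraMap k K) g • T).map (σ : K →+* K) =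
      Matrix.SpecialLinearGroup.map (algebraMap k K) g • T.map (σ : K →+* K) := by
  rw [map_smul_cubic]
  congr 1
  ext i j
  simp

theorem IsConjSum.smul {σ : K ≃ₐ[k] K} {P : BinaryCubic k} {l : Kˣ} {φ : Fin 2 → K}
    (h : IsConjSum σ P l φ) (g : Matrix.SpecialLinearGroup (Fin 2) k) :
    IsConjSum σ (g • P) l (formAct (Matrix.SpecialLinearGroup.map (algebraMap k K) g) φ) := by
  rw [isConjSum_iff] at *
  rw [← formAct_conjForm, formDet_formAct, map_smul_cubic, h.1, smul_add_cubic, smul_scale_cube,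
    smul_scale_cube]
  exact ⟨rfl, h.2⟩

theorem orbitInvariant_smul (h2 : (2 : K) ≠ 0) {σ : K ≃ₐ[k] K} {P : BinaryCubic k}
    (hP : P ∈ quadOrbits σ) (g : Matrix.SpecialLinearGroup (Fin 2) k) :
    orbitInvariant ((g • P).map (algebraMap k K)) = orbitInvariant (P.map (algebraMap k K)) := by
  obtain ⟨l, φ, h⟩ := exists_isConjSum h2 hP
  obtain ⟨q, hq⟩ := h.exists_unit_eq_omega
  rw [IsCubeSum.orbitInvariant_eq h2 h hq, IsCubeSum.orbitInvariant_eq h2 (h.smul g)]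
  refine hq.trans ?_
  change _ = omega _ (scale (σ l) _)
  rw [omega_scale_cube, omega_scale_cube, ← formAct_conjForm, formDet_formAct]

theorem exists_smul_eq_of_class_eq (hK : Module.finrank k K = 2) {σ : K ≃ₐ[k] K} (hσ : σ ≠ 1)
    {P P' : BinaryCubic k} {l l' : Kˣ} {φ φ' : Fin 2 → K} (h : IsConjSum σ P l φ)
    (h' : IsConjSum σ P' l' φ')
    (hω : omega (scale (l : K) (cube φ)) (scale (σ l) (cube (conjForm σ φ))) =
      omega (scale (l' : K) (cube φ')) (scale (σ l') (cube (conjForm σ φ'))))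
    (hc : CubeClass.mk l * (CubeClass.mk (conjUnit σ l))⁻¹ =
      CubeClass.mk l' * (CubeClass.mk (conjUnit σ l'))⁻¹) :
    ∃ g : Matrix.SpecialLinearGroup (Fin 2) k, g • P = P' := by
  rw [isConjSum_iff] at h h'
  rw [omega_scale_cube, omega_scale_cube] at hω
  obtain ⟨g, hg⟩ := exists_smul_scale_cube_eq hK hσ h.2 hω hc
  refine ⟨g, map_injective (algebraMap k K) ?_⟩
  -- Since `g` has entries in `k`, it also carries the conjugate summand to the conjugate summand.
  have hg' := congrArg (map (σ : K →+* K)) hg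
  rw [map_conj_smul, map_scale_cube, map_scale_cube] at hg'
  rw [map_smul_cubic, h.1, h'.1, smul_add_cubic, hg]
  exact congrArg _ hg'

theorem exists_smul_eq_of_orbitInvariant_eq (h2 : (2 : K) ≠ 0) (hK : Module.finrank k K = 2)
    {σ : K ≃ₐ[k] K} (hσ : σ ≠ 1) {P P' : BinaryCubic k} (hP : P ∈ quadOrbits σ)
    (hP' : P' ∈ quadOrbits σ)
    (h : orbitInvariant (P.map (algebraMap k K)) = orbitInvariant (P'.map (algebraMap k K))) :
    ∃ g : Matrix.SpecialLinearGroup (Fin 2) k, g • P = P' := by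
  have hσσ := conj_conj hK hσ
  obtain ⟨l, φ, hs⟩ := exists_isConjSum h2 hP
  obtain ⟨l', φ', hs'⟩ := exists_isConjSum h2 hP'
  obtain ⟨q, hq⟩ := hs.exists_unit_eq_omega
  obtain ⟨q', hq'⟩ := hs'.exists_unit_eq_omega
  rw [IsCubeSum.orbitInvariant_eq h2 hs hq, IsCubeSum.orbitInvariant_eq h2 hs' hq',
    OrbitParam.mk_eq_mk_iff] at h
  rcases h with ⟨rfl, hc⟩ | ⟨rfl, hc⟩
  · exact exists_smul_eq_of_class_eq hK hσ hs hs' (hq.symm.trans hq') hc.symm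
  -- When the signs are opposite, the roles of `T` and `T̄` in `P` are exchanged.
  · have hl : conjUnit σ (conjUnit σ l) = l := Units.ext (hσσ l)
    refine exists_smul_eq_of_class_eq hK hσ (hs.conj hσσ) hs' ?_ ?_
    · rw [conjForm_conjForm hσσ, ← hq', Units.val_neg, hq, ← omega_swap]
      change omega (scale (σ l) _) (scale (σ (σ l)) _) = _
      rw [hσσ]
    · rw [hl, hc]
      simp

/-! ### The image of the invariant. -/

theorem orbitInvariant_mem_unitaryParam (h2 : (2 : K) ≠ 0) {σ : K ≃ₐ[k] K}
    (hσσ : ∀ x, σ (σ x) = x) {P : BinaryCubic k} (hP : P ∈ quadOrbits σ) :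
    orbitInvariant (P.map (algebraMap k K)) ∈ unitaryParam σ := by
  obtain ⟨l, φ, hs⟩ := exists_isConjSum h2 hP
  obtain ⟨q, hq⟩ := hs.exists_unit_eq_omega
  refine ⟨q, _, ?_, ?_, IsCubeSum.orbitInvariant_eq h2 hs hq⟩
  · rw [hq, conj_omega hσσ]
  · have hl : conjUnit σ (conjUnit σ l) = l := Units.ext (hσσ l)
    rw [mem_unitaryClasses, map_mul, map_inv, conjClass_mk, conjClass_mk,
      show Units.map (σ : K →* K) (conjUnit σ l) = l from hl]
    group

theorem exists_orbitInvariant_eq (h2 : (2 : K) ≠ 0) (hK : Module.finrank k K = 2)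
    {σ : K ≃ₐ[k] K} (hσ : σ ≠ 1) {x : OrbitParam K} (hx : x ∈ unitaryParam σ) :
    ∃ P ∈ quadOrbits σ, orbitInvariant (P.map (algebraMap k K)) = x := by
  have hσσ := conj_conj hK hσ
  obtain ⟨q, s, hq, hs, rfl⟩ := hx
  obtain ⟨t, rfl⟩ : ∃ t, CubeClass.mk t = s := QuotientGroup.mk'_surjective _ s
  rw [mem_unitaryClasses, conjClass_mk, ← map_mul, ← map_one CubeClass.mk, eq_comm,
    mk_eq_mk_iff] at hs
  obtain ⟨c, hc⟩ := hs
  have hc : (c : K) ^ 3 = t * σ t := by simpa using congrArg Units.val hc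
  have hq0 := q.ne_zero
  have ht0 := t.ne_zero
  have hσt0 : σ t ≠ 0 := by simp
  have hc0 := c.ne_zero
  have hσc0 : σ c ≠ 0 := by simp
  -- a cube root of `t t̄` fixed by conjugation
  obtain ⟨w, hw0, hσw, hw⟩ : ∃ w : K, w ≠ 0 ∧ σ w = w ∧ w ^ 3 = t * σ t := by
    -- Both `c` and `c̄` have cube `t t̄`, so the cube of this quotient is `(t t̄)³ / (t t̄)²`.
    refine ⟨t * σ t / (c * σ c), by positivity, ?_, ?_⟩
    · simp only [map_div₀, map_mul, hσσ]
      rw [mul_comm (σ (t : K)), mul_comm (σ (c : K))]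
    · have hσc : (σ c) ^ 3 = t * σ t := by
        rw [← map_pow, hc, map_mul, hσσ, mul_comm]
      rw [div_pow, mul_pow (c : K), hc, hσc]
      field_simp
  -- Modulo cubes `t̄` is `t⁻¹`, and `q²` is fixed by conjugation, so `l / l̄` has the class of
  -- `t⁴`, that is, of `t`. The form `x + e y` has determinant `ē - e = 1 / (q w²)` with its
  -- conjugate, whence `l l̄ D³ = (t t̄)² q⁴ / (q³ w⁶) = q`.
  let l : Kˣ := t ^ 2 * q ^ 2
  let e : K := -(1 / (2 * q * w ^ 2))
  let φ : Fin 2 → K := ![1, e]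
  have hσe : σ e = -e := by
    simp only [e, map_neg, map_div₀, map_mul, map_pow, map_one, map_ofNat, hq, hσw,
      mul_neg, neg_mul, div_neg]
  have hD : formDet φ (conjForm σ φ) = 1 / (q * w ^ 2) := by
    have : formDet φ (conjForm σ φ) = σ e - e := by simp [formDet, φ]
    rw [this, hσe]
    simp only [e]
    field_simp
    ring
  have hω : omega (scale (l : K) (cube φ)) (scale (σ l) (cube (conjForm σ φ))) = q := by
    rw [omega_scale_cube, hD]
    simp only [l, Units.val_mul, Units.val_pow_eq_pow_val, map_mul, map_pow, hq]
    field_simp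
    rw [show w ^ 6 = (w ^ 3) ^ 2 by ring, hw]
    ring
  -- The coefficients of `T + T̄` are traces, so they come from `k`.
  have descend : ∀ x : K, ∃ y : k, algebraMap k K y = x + σ x := fun x =>
    exists_algebraMap_eq hK hσ (by rw [map_add, hσσ, add_comm])
  obtain ⟨a, ha⟩ := descend (scale (l : K) (cube φ)).a
  obtain ⟨b, hb⟩ := descend (scale (l : K) (cube φ)).b
  obtain ⟨c', hc'⟩ := descend (scale (l : K) (cube φ)).c
  obtain ⟨d, hd⟩ := descend (scale (l : K) (cube φ)).d
  have hP : IsConjSum σ ⟨a, b, c', d⟩ l φ := by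
    refine isConjSum_iff.mpr ⟨?_, by rw [hD]; exact one_div_ne_zero (by positivity)⟩
    have := map_scale_cube (σ : K →+* K) (l : K) φ
    refine Eq.trans ?_ (congrArg (scale (l : K) (cube φ) + ·) this)
    ext
    exacts [ha, hb, hc', hd]
  refine ⟨_, hP.mem_quadOrbits hσσ, ?_⟩
  rw [IsCubeSum.orbitInvariant_eq h2 hP hω.symm]
  congr 1
  rw [mul_inv_eq_iff_eq_mul, ← map_mul, mk_eq_mk_iff]
  refine ⟨Units.mk0 (w ^ 2 / t) (by positivity), ?_⟩
  ext
  simp only [l, conjUnit, Units.val_mul, Units.val_pow_eq_pow_val, Units.coe_map, Units.val_mk0,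
    MonoidHom.coe_coe, map_mul, map_pow, hq]
  field_simp
  rw [show w ^ 6 = (w ^ 3) ^ 2 by ring, hw]
  ring

/-! ### Isotropy groups. -/

theorem nonempty_stabilizer_mulEquiv (h2 : (2 : K) ≠ 0) (hK : Module.finrank k K = 2)
    {σ : K ≃ₐ[k] K} (hσ : σ ≠ 1) {P : BinaryCubic k} (hP : P ∈ quadOrbits σ) :
    Nonempty (MulAction.stabilizer (Matrix.SpecialLinearGroup (Fin 2) k) P ≃* diagGroup σ) := by
  obtain ⟨l, φ, hs⟩ := exists_isConjSum h2 hP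
  have hD := (isConjSum_iff.mp hs).2
  have hφ := formDet_ne_zero_left hD
  have smul_inj : ∀ {z w : K}, z • φ = w • φ → z = w := fun h => smul_left_injective K hφ h
  have key : ∀ g : MulAction.stabilizer (Matrix.SpecialLinearGroup (Fin 2) k) P, ∃ z : K,
      (z ^ 3 = 1 ∧ z * σ z = 1) ∧
      formAct (Matrix.SpecialLinearGroup.map (algebraMap k K) g.1) φ = z • φ := by
    rintro ⟨g, hg⟩
    have hg : g • P = P := hg
    have hs' := hs.smul g
    rw [hg] at hs'
    set ψ := formAct (Matrix.SpecialLinearGroup.map (algebraMap k K) g) φ with hψ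
    have hdet : formDet ψ (conjForm σ ψ) = formDet φ (conjForm σ φ) := by
      rw [hψ, ← formAct_conjForm, formDet_formAct]
    -- The action preserves `ω(T, T̄)`, so a stabilizing element fixes the summand `T` and not
    -- merely the pair `T, T̄`.
    have hT : scale (l : K) (cube φ) = scale (l : K) (cube ψ) := by
      rw [← IsCubeSum.summand_eq h2 hs, ← IsCubeSum.summand_eq h2 hs', omega_scale_cube,
        omega_scale_cube, hdet]
    obtain ⟨z, hz, hzφ⟩ := exists_smul_eq_of_cube_eq hφ (scale_injective l.ne_zero hT)
    refine ⟨z, ⟨hz, ?_⟩, hzφ⟩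
    rw [hzφ, conjForm_smul, formDet_smul] at hdet
    exact mul_right_cancel₀ hD (by rw [hdet, one_mul])
  choose z hz hzφ using key
  let f : MulAction.stabilizer (Matrix.SpecialLinearGroup (Fin 2) k) P →* diagGroup σ :=
    MonoidHom.mk' (fun g => ⟨⟨!![z g, 0; 0, σ (z g)], by simp [(hz g).2]⟩,
      ⟨z g, rfl, (hz g).1, (hz g).2⟩⟩) (by
      intro g h
      have hmul : z (g * h) = z g * z h := by
        apply smul_inj
        rw [← hzφ, Subgroup.coe_mul, map_mul, formAct_mul, hzφ h, formAct_smul, hzφ g, smul_smul,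
          mul_comm]
      apply Subtype.ext
      apply Subtype.ext
      rw [Subgroup.coe_mul, Matrix.SpecialLinearGroup.coe_mul]
      simp [hmul])
  refine ⟨MulEquiv.ofBijective f ⟨?_, ?_⟩⟩
  · rw [injective_iff_map_eq_one]
    intro g hg
    have hz1 : z g = 1 := by
      have := congrFun (congrFun (congrArg (fun x => x.1.1) hg) 0) 0
      simpa [f] using this
    have h1 : formAct (Matrix.SpecialLinearGroup.map (algebraMap k K) g.1) φ = φ := by
      rw [hzφ, hz1, one_smul]
    -- An element over `k` fixing `φ` also fixes `φ̄`, which is independent of `φ`.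
    have := eq_one_of_formAct_eq hD h1 (by rw [formAct_conjForm, h1])
    apply Subtype.ext
    ext i j
    apply (algebraMap k K).injective
    have := congrArg (fun x => x.1 i j) this
    fin_cases i <;> fin_cases j <;> simpa using this
  · rintro ⟨x, w, hx, hw3, hw⟩
    -- Because `w w̄ = 1`, the forms `φ` and `w φ` have the same determinant with their conjugates;
    -- `w³ = 1` then makes `g` fix `P`.
    obtain ⟨g, hg⟩ := exists_formAct_eq hK hσ (φ' := w • φ) hD (by
      rw [conjForm_smul, formDet_smul, hw, one_mul])
    have hgP : g • P = P := by
      apply map_injective (algebraMap k K)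
      have hs' := (isConjSum_iff.mp (hs.smul g)).1
      rw [hs', hg, (isConjSum_iff.mp hs).1, conjForm_smul, scale_cube_smul, scale_cube_smul, hw3,
        ← map_pow, hw3, map_one, mul_one, mul_one]
    refine ⟨⟨g, hgP⟩, ?_⟩
    have hzw : z ⟨g, hgP⟩ = w := smul_inj (by rw [← hzφ, hg])
    apply Subtype.ext
    apply Subtype.ext
    simp [f, hx, hzw]

end Conjugation

end BinaryCubic

/-! ### The classification of the orbits. -/

theorem mainTheorem3 {k K : Type*} [Field k] [Field K] [Algebra k K]
    (h2 : (2 : k) ≠ 0) (h3 : (3 : k) ≠ 0) (hK : Module.finrank k K = 2)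
    (σ : K ≃ₐ[k] K) (hσ : σ ≠ 1) :
    -- the three descriptions of the set of cubics agree
    ((BinaryCubic.quadOrbits σ : Set (BinaryCubic k)) =
        {P | Polynomial.IsSplittingField k K (Polynomial.X ^ 2 - Polynomial.C P.Qn)} ∧
      (BinaryCubic.quadOrbits σ : Set (BinaryCubic k)) = BinaryCubic.conjSums σ) ∧
    -- the invariant over `K` is well defined: every decomposition computes it
    (∀ P ∈ BinaryCubic.quadOrbits σ, ∀ (l₁ l₂ : Kˣ) (φ₁ φ₂ : Fin 2 → K),
      BinaryCubic.IsCubeSum (P.map (algebraMap k K)) l₁ l₂ φ₁ φ₂ →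
      ∃ q : Kˣ,
        (q : K) = BinaryCubic.omega (BinaryCubic.scale (l₁ : K) (BinaryCubic.cube φ₁))
          (BinaryCubic.scale (l₂ : K) (BinaryCubic.cube φ₂)) ∧
        BinaryCubic.orbitInvariant (P.map (algebraMap k K)) =
          BinaryCubic.OrbitParam.mk q
            (BinaryCubic.CubeClass.mk l₁ * (BinaryCubic.CubeClass.mk l₂)⁻¹)) ∧
    -- it separates the orbits
    (∀ P ∈ BinaryCubic.quadOrbits σ, ∀ P' ∈ BinaryCubic.quadOrbits σ,
      MulAction.orbit (Matrix.SpecialLinearGroup (Fin 2) k) P' =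
          MulAction.orbit (Matrix.SpecialLinearGroup (Fin 2) k) P ↔
        BinaryCubic.orbitInvariant (P'.map (algebraMap k K)) =
          BinaryCubic.orbitInvariant (P.map (algebraMap k K))) ∧
    -- it induces a bijection from the orbit space onto `Im K* ×_{Z₂} U(K*/K*³)`
    (∃ e : MulAction.orbitRel.Quotient (Matrix.SpecialLinearGroup (Fin 2) k)
          (BinaryCubic.quadOrbits σ) ≃ BinaryCubic.unitaryParam σ,
      ∀ P : BinaryCubic.quadOrbits σ,
        (e (Quotient.mk (MulAction.orbitRel (Matrix.SpecialLinearGroup (Fin 2) k)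
            (BinaryCubic.quadOrbits σ)) P) : BinaryCubic.OrbitParam K) =
          BinaryCubic.orbitInvariant ((P : BinaryCubic k).map (algebraMap k K))) ∧
    -- isotropy groups
    (∀ P ∈ BinaryCubic.quadOrbits σ,
      Nonempty (MulAction.stabilizer (Matrix.SpecialLinearGroup (Fin 2) k) P ≃*
        BinaryCubic.diagGroup σ)) := by
  have h2K : (2 : K) ≠ 0 := by
    rw [← map_ofNat (algebraMap k K) 2]
    simpa using h2
  have hσσ := BinaryCubic.conj_conj hK hσ
  refine ⟨⟨BinaryCubic.coe_quadOrbits_eq_isSplittingField h2K hK hσ,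
    BinaryCubic.coe_quadOrbits_eq_conjSums h2K hσσ⟩, ?_, ?_, ?_, ?_⟩
  · intro P _ l₁ l₂ φ₁ φ₂ h
    exact ⟨Units.mk0 _ h.omega_ne_zero, rfl, h.orbitInvariant_eq h2K rfl⟩
  · intro P hP P' hP'
    rw [MulAction.orbit_eq_iff]
    constructor
    · rintro ⟨g, rfl⟩
      exact BinaryCubic.orbitInvariant_smul h2K hP g
    · intro h
      exact BinaryCubic.exists_smul_eq_of_orbitInvariant_eq h2K hK hσ hP hP' h.symm
  · let f : MulAction.orbitRel.Quotient (Matrix.SpecialLinearGroup (Fin 2) k)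
        (BinaryCubic.quadOrbits σ) → BinaryCubic.unitaryParam σ :=
      Quotient.lift (fun P => ⟨BinaryCubic.orbitInvariant ((P : BinaryCubic k).map
        (algebraMap k K)), BinaryCubic.orbitInvariant_mem_unitaryParam h2K hσσ P.2⟩) (by
        rintro P R ⟨g, rfl⟩
        exact Subtype.ext (BinaryCubic.orbitInvariant_smul h2K R.2 g))
    refine ⟨Equiv.ofBijective f ⟨?_, ?_⟩, fun P => rfl⟩
    · rintro ⟨P⟩ ⟨R⟩ h
      obtain ⟨g, hg⟩ := BinaryCubic.exists_smul_eq_of_orbitInvariant_eq h2K hK hσ R.2 P.2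
        (congrArg Subtype.val h).symm
      exact Quotient.sound ⟨g, Subtype.ext hg⟩
    · rintro ⟨x, hx⟩
      obtain ⟨P, hP, rfl⟩ := BinaryCubic.exists_orbitInvariant_eq h2K hK hσ hx
      exact ⟨Quotient.mk _ ⟨P, hP⟩, rfl⟩
  · intro P hP
    exact BinaryCubic.nonempty_stabilizer_mulEquiv h2K hK hσ hP
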